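/- There is an absolute constant $C>0$ with the following property. Let $k\ge 1$, $V=[n]$, and let $(k+1)^V$ be the set of $k$-tuples $\boldsymbol{x}=(X_1,\dots,X_k)$ of pairwise disjoint subsets of $V$; write $\operatorname{supp}(\boldsymbol{x})=\bigcup_i X_i$. Let $(V,\mathcal F)$ be a matroid of rank $M$, and call $\boldsymbol{x}$ feasible if $\operatorname{supp}(\boldsymbol{x})\in\mathcal F$. Let $f_1,f_2,\dots$ be independent, identically distributed random functions $(k+1)^V\to\mathbb R$ whose values lie in $[0,1]$ almost surely, and suppose that the expected reward $f(\boldsymbol{x})=\mathbb E[f_t(\boldsymbol{x})]$ is * $k$-submodular: $f(\boldsymbol{x})+f(\boldsymbol{y})\ge f(\boldsymbol{x}\sqcup\boldsymbol{y})+f(\boldsymbol{x}\sqcap\boldsymbol{y})$ for all $\boldsymbol{x},\boldsymbol{y}$, where the $i$-th set of $\boldsymbol{x}\sqcap\boldsymbol{y}$ is $X_i\cap Y_i$ and that of $\boldsymbol{x}\sqcup\boldsymbol{y}$ is $(X_i\cup Y_i)\setminus\bigcup_{j\ne i}(X_j\cup Y_j)$; and * monotone: $\Delta_{e,i}f(\boldsymbol{x})=f(\boldsymbol{x}+(e,i))-f(\boldsymbol{x})\ge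 0$ for all $\boldsymbol{x}$, $e\notin\operatorname{supp}(\boldsymbol{x})$ and $i\in[k]$, where $\boldsymbol{x}+(e,i)$ is $\boldsymbol{x}$ with $e$ added to $X_i$. Sakaue's greedy algorithm, with access to a value oracle $\hat f$, starts from $\boldsymbol{s}=\boldsymbol{0}=(\emptyset,\dots,\emptyset)$ and repeats the following $M$ times: query $\hat f(\boldsymbol{s}+(e,i))$ for all $i\in[k]$ and all $e\notin\operatorname{supp}(\boldsymbol{s})$ with $\operatorname{supp}(\boldsymbol{s})\cup\{e\}\in\mathcal F$, in any order, and replace $\boldsymbol{s}$ by an $\boldsymbol{s}+(e,i)$ of largest value (equivalently, with the largest marginal gain), ties being broken by any fixed measurable rule. It then returns $\boldsymbol{s}$. C-ETC with horizon $T$ and parameters $\delta=M+1$, $N=nkM$ runs this algorithm and answers each query $\hat f(A)$ by playing the action $A$ in the next $$m=\left\lceil\frac{\delta^{2/3}T^{2/3}\log(T)^{1/3}}{2N^{2/3}}\right\rceil$$ rounds and returning the average of the $m$ rewards $f_t(A)$ observed in them; after the greedy algorithm has returned $\boldsymbol{s}$, the action $\boldsymbol{s}$ is played in all remaining rounds.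 (If $M=0$ there are no queries.) Let $A_t$ be the action played in round $t$, and let $\mathrm{OPT}$ maximise $f$ over the feasible solutions. If $$T\ \ge\ nk\max\left\{1,\frac{3\sqrt2\,M}{2(M+1)}\right\},$$ then the expected cumulative $1/2$-regret satisfies $$\tfrac12\,T f(\mathrm{OPT})-\mathbb E\Big[\sum_{t=1}^{T}f_t(A_t)\Big]\ \le\ C\,n^{1/3}k^{1/3}M\,T^{2/3}\log(T)^{1/3}.$$ -/

import Mathlib

open MeasureTheory ProbabilityTheory

noncomputable section

namespace KBandit

/-! ### `k`-submodular functions -/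

/-- The set `(k+1)^V` for `V = [n]`: an element `e` either has no type (`none`) or exactly one
type `i` (`some i`). The tuple `(X₁, …, X_k)` of pairwise disjoint sets is recovered as
`Xᵢ = {e | x e = some i}`. -/
abbrev Assignment (n k : ℕ) : Type := Fin n → Option (Fin k)

/-- `Xᵢ`, the set of elements of type `i`. -/
def typeSet {n k : ℕ} (x : Assignment n k) (i : Fin k) : Set (Fin n) := {e | x e = some i}

/-- The elements that have a type. -/
def support {n k : ℕ} (x : Assignment n k) : Set (Fin n) := {e | x e ≠ none}

/-- `x ⊓ y = (X₁ ∩ Y₁, …, X_k ∩ Y_k)`. -/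
def meet {n k : ℕ} (x y : Assignment n k) : Assignment n k :=
  fun e => if x e = y e then x e else none

/-- `x ⊔ y`, whose `i`-th set is `(Xᵢ ∪ Yᵢ) ∖ ⋃_{j ≠ i} (X_j ∪ Y_j)`. -/
def join {n k : ℕ} (x y : Assignment n k) : Assignment n k :=
  fun e => if x e = none then y e else if y e = none ∨ x e = y e then x e else none

theorem typeSet_meet {n k : ℕ} (x y : Assignment n k) (i : Fin k) :
    typeSet (meet x y) i = typeSet x i ∩ typeSet y i := by
  ext e
  simp only [typeSet, meet, Set.mem_inter_iff, Set.mem_ofPred_eq]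
  grind

theorem typeSet_join {n k : ℕ} (x y : Assignment n k) (i : Fin k) :
    typeSet (join x y) i =
      (typeSet x i ∪ typeSet y i) \ ⋃ j ∈ {j | j ≠ i}, (typeSet x j ∪ typeSet y j) := by
  ext e
  simp only [typeSet, join, Set.mem_sdiff, Set.mem_union, Set.mem_iUnion, Set.mem_ofPred_eq]
  rcases hx : x e with _ | a <;> rcases hy : y e with _ | b <;> grind

def IsKSubmodular {n k : ℕ} (f : Assignment n k → ℝ) : Prop :=
  ∀ x y, f (join x y) + f (meet x y) ≤ f x + f y

/-- The solution obtained from `x` by giving type `i` to `e`. -/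
def assign {n k : ℕ} (x : Assignment n k) (e : Fin n) (i : Fin k) : Assignment n k :=
  Function.update x e (some i)

/-- The marginal gain `Δ_{e,i} f(x)`. -/
def marginalGain {n k : ℕ} (f : Assignment n k → ℝ) (x : Assignment n k) (e : Fin n)
    (i : Fin k) : ℝ :=
  f (assign x e i) - f x

def IsMonotone {n k : ℕ} (f : Assignment n k → ℝ) : Prop :=
  ∀ x e i, e ∉ support x → 0 ≤ marginalGain f x e i

/-! ### Matroid constraint -/

/-- The feasible solutions: those whose support is independent. -/
def feasible {n : ℕ} (k : ℕ) (𝓜 : Matroid (Fin n)) : Set (Assignment n k) :=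
  {x | 𝓜.Indep (support x)}

/-- `E(s)`: the elements without a type that can be added to `s` keeping it feasible. -/
def available {n k : ℕ} (𝓜 : Matroid (Fin n)) (s : Assignment n k) : Set (Fin n) :=
  {e | e ∉ support s ∧ 𝓜.Indep (insert e (support s))}

/-! ### Algorithms with a value oracle, and C-ETC -/

/-- A deterministic algorithm with access to a value oracle for functions on `X`: it either returns
an element of `X`, or asks for the value at a point and continues depending on the answer. -/
inductive OracleAlg (X : Type) : Type
  | ret (S : X) : OracleAlg X
  | query (A : X) (next : ℝ → OracleAlg X) : OracleAlg X

/-- The action that C-ETC plays in round `t` (rounds are numbered from `0`), when it runs the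
offline algorithm with `m` repetitions per query and `F s A` is the reward of action `A` in
round `s`. Each query `A` is answered by playing `A` for `m` rounds and returning the empirical mean
of these `m` rewards. Once the offline algorithm has returned `S`, the action is `S` forever. -/
def OracleAlg.cetcAction {X : Type} (m : ℕ) : OracleAlg X → (ℕ → X → ℝ) → ℕ → X
  | .ret S, _, _ => S
  | .query A next, F, t =>
      if t < m then A
      else (next ((∑ s ∈ Finset.range m, F s A) / m)).cetcAction m (fun s => F (s + m)) (t - m)

/-- The number of repetitions `m = ⌈δ^{2/3} T^{2/3} log(T)^{1/3} / (2 N^{2/3})⌉` of C-ETC. -/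
def cetcReps (δ : ℝ) (N T : ℕ) : ℕ :=
  ⌈δ ^ (2 / 3 : ℝ) * (T : ℝ) ^ (2 / 3 : ℝ) * Real.log T ^ (1 / 3 : ℝ) /
    (2 * (N : ℝ) ^ (2 / 3 : ℝ))⌉₊

/-! ### The greedy algorithm under a matroid constraint -/

/-- Query, in the order of the list, the values of `s` extended by each of the listed
element-type pairs, and hand the table of answers to the continuation `c`. -/
def queryAll {n k : ℕ} (s : Assignment n k)
    (c : (Fin n × Fin k → ℝ) → OracleAlg (Assignment n k)) :
    List (Fin n × Fin k) → (Fin n × Fin k → ℝ) → OracleAlg (Assignment n k)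
  | [], v => c v
  | p :: L, v => .query (assign s p.1 p.2) (fun y => queryAll s c L (Function.update v p y))

/-- What the pseudo-code of the greedy algorithm leaves open: the order in which the extensions of
the current solution are evaluated, and the choice of a maximiser when there are several. -/
structure GreedyRule {n : ℕ} (k : ℕ) (𝓜 : Matroid (Fin n)) where
  /-- an enumeration of the available pairs `(e, i)`, `e ∈ E(s)`, `i ∈ [k]` -/
  order : Assignment n k → List (Fin n × Fin k)
  order_nodup : ∀ s, (order s).Nodup
  mem_order : ∀ s p, p ∈ order s ↔ p.1 ∈ available 𝓜 s
  /-- the selected pair, given the table `v` of the oracle values `v (e, i)` of `s` extended by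
  `(e, i)`; `none` only if there is no available pair -/
  select : Assignment n k → (Fin n × Fin k → ℝ) → Option (Fin n × Fin k)
  /-- The selected pair has the largest marginal gain: the gain of `(e, i)` is `v (e, i)` minus
  the value of `s`, which is the same for all pairs. -/
  select_spec : ∀ s v, order s ≠ [] →
    ∃ p ∈ order s, select s v = some p ∧ ∀ q ∈ order s, v q ≤ v p
  measurableSet_select : ∀ s p, MeasurableSet {v | select s v = p}

/-- The greedy algorithm with `r` iterations left and current solution `s`. -/
def greedyFrom {n k : ℕ} {𝓜 : Matroid (Fin n)} (rule : GreedyRule k 𝓜) :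
    ℕ → Assignment n k → OracleAlg (Assignment n k)
  | 0, s => .ret s
  | r + 1, s =>
      queryAll s
        (fun v => match rule.select s v with
          | some p => greedyFrom rule r (assign s p.1 p.2)
          | none => .ret s)
        (rule.order s) 0

/-- The greedy algorithm: `M` iterations, started from the solution without any types. -/
def greedy {n k : ℕ} {𝓜 : Matroid (Fin n)} (rule : GreedyRule k 𝓜) (M : ℕ) :
    OracleAlg (Assignment n k) :=
  greedyFrom rule M (fun _ => none)

/-! ### The bandit problem -/

/-- The action played in round `t` by C-ETC with horizon `T` and the greedy algorithm, whose
parameters are `δ = M + 1` and `N = n k M`, when the reward functions are `F 0, F 1, …`. -/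
def greedyCETC {n k : ℕ} {𝓜 : Matroid (Fin n)} (rule : GreedyRule k 𝓜) (M T : ℕ)
    (F : ℕ → Assignment n k → ℝ) (t : ℕ) : Assignment n k :=
  (greedy rule M).cetcAction (cetcReps (M + 1) (n * k * M) T) F t

/-- The expected reward of an action, `f(A) = 𝔼[f_t(A)]` (the same for all `t`). -/
def expectedReward {Ω X : Type*} [MeasurableSpace Ω] (P : Measure Ω) (F : ℕ → Ω → X → ℝ)
    (A : X) : ℝ :=
  ∫ ω, F 0 ω A ∂P

/-- The random reward functions `f_t` are independent and identically distributed over the rounds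
`t`, with values in `[0,1]`. Values of the same `f_t` at different actions may be dependent. -/
structure IsRewardProcess {Ω X : Type*} [MeasurableSpace Ω] (P : Measure Ω)
    (F : ℕ → Ω → X → ℝ) : Prop where
  measurable : ∀ t, Measurable (F t)
  indep : iIndepFun F P
  identDistrib : ∀ t, IdentDistrib (F t) (F 0) P P
  mem_Icc : ∀ t A, ∀ᵐ ω ∂P, F t ω A ∈ Set.Icc (0 : ℝ) 1

/-- The expected cumulative `α`-regret `α T f(OPT) - 𝔼[∑_t f_t(A_t)]` over the rounds
`0, …, T - 1`, where `A t ω` is the action played in round `t`. -/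
def expectedRegret {Ω X : Type*} [MeasurableSpace Ω] (P : Measure Ω) (F : ℕ → Ω → X → ℝ)
    (α : ℝ) (T : ℕ) (OPT : X) (A : ℕ → Ω → X) : ℝ :=
  α * T * expectedReward P F OPT - ∫ ω, ∑ t ∈ Finset.range T, F t ω (A t ω) ∂P

end KBandit

end

open KBandit

namespace KBandit

/-! ### Monotone `k`-submodular functions -/

/-! Offline part: greedy with an oracle that is exact up to `ε` returns `S` with `f OPT ≤ 2 f S + 2
M ε`. By monotonicity `OPT` may be replaced by an extension `o` supported on a base. Along the run,
`o` extends the current solution `s`: when greedy adds `(e, i)`, matroid exchange removes some `b`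
from `o` in favour of `e`. Diminishing returns bound the loss of `o` by the gain of `b` at `s`,
hence by the greedy gain plus `2ε`. So `f o + f s` drops by at most `2ε` per step, and at the end `o
= s = S` (`greedyFrom_ensures`).

Bandit part: the action of a block depends only on earlier rewards, so the block's rewards are
independent of it and Hoeffding applies to each answer (`IsPolicy.measureReal_deviation_le`). With
`N = nkM`, a union bound over `N` blocks gives regret at most `N m + T M ε + 2 T N exp (-2 m ε²)`
(`IsPolicy.regret_le`). For `ε = √(log T / m)` each of the three terms has the claimed order
(`parameter_bound`). -/

/-- `y` agrees with `x` on the support of `x`. -/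
def Extends {n k : ℕ} (x y : Assignment n k) : Prop := ∀ e, x e ≠ none → y e = x e

theorem Extends.support_subset {n k : ℕ} {x y : Assignment n k} (h : Extends x y) :
    support x ⊆ support y := by
  intro e he
  simp only [support, Set.mem_ofPred_eq] at he ⊢
  rwa [h e he]

theorem Extends.eq_of_support_subset {n k : ℕ} {x y : Assignment n k} (h : Extends x y)
    (hs : support y ⊆ support x) : x = y := by
  funext e
  by_cases he : x e = none
  · by_contra hne
    exact hs (show y e ≠ none from fun h' => hne (he.trans h'.symm)) he
  · exact (h e he).symm

theorem support_assign {n k : ℕ} (x : Assignment n k) (e : Fin n) (i : Fin k) :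
    support (assign x e i) = insert e (support x) := by
  ext a
  by_cases h : a = e
  · subst h; simp [support, assign]
  · simp [support, assign, h]

theorem support_update_none {n k : ℕ} (x : Assignment n k) (e : Fin n) :
    support (Function.update x e none) = support x \ {e} := by
  ext a
  by_cases h : a = e
  · subst h; simp [support]
  · simp [support, h]

/-- Diminishing returns: `k`-submodularity for `x + (e, i)` and `y`, whose join is `y + (e, i)` and
whose meet is `x`. -/
theorem IsKSubmodular.marginalGain_le_of_extends {n k : ℕ} {f : Assignment n k → ℝ}
    (hf : IsKSubmodular f) {x y : Assignment n k} (h : Extends x y) {e : Fin n}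
    (he : e ∉ support y) (i : Fin k) : marginalGain f y e i ≤ marginalGain f x e i := by
  have hye : y e = none := by simpa [support] using he
  have hxe : x e = none := by
    by_contra hx
    exact hx ((h e hx).symm.trans hye)
  have h1 : join (assign x e i) y = assign y e i := by
    funext a
    by_cases ha : a = e
    · subst ha; simp [join, assign, hye]
    · simp only [join, assign, Function.update_of_ne ha]
      have := h a
      grind
  have h2 : meet (assign x e i) y = x := by
    funext a
    by_cases ha : a = e
    · subst ha; simp [meet, assign, hye, hxe]
    · simp only [meet, assign, Function.update_of_ne ha]
      have := h a
      grind
  have := hf (assign x e i) y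
  rw [h1, h2] at this
  unfold marginalGain
  linarith

theorem IsMonotone.le_of_extends {n k : ℕ} {f : Assignment n k → ℝ} (hf : IsMonotone f)
    {x y : Assignment n k} (h : Extends x y) : f x ≤ f y := by
  obtain ⟨d, hd⟩ : ∃ d, d = (Finset.univ.filter fun e => x e ≠ y e).card := ⟨_, rfl⟩
  induction d generalizing x with
  | zero =>
    have : x = y := by
      funext e
      by_contra hne
      have := Finset.card_eq_zero.1 hd.symm
      exact Finset.eq_empty_iff_forall_notMem.1 this e (by simpa using hne)
    rw [this]
  | succ d ih =>
    obtain ⟨e, he⟩ : (Finset.univ.filter fun e => x e ≠ y e).Nonempty :=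
      Finset.card_pos.1 (by omega)
    have hne : x e ≠ y e := by simpa using he
    have hx : x e = none := by
      by_contra hx
      exact hne (h e hx).symm
    obtain ⟨i, hi⟩ := Option.ne_none_iff_exists'.1 (fun hy => hne (hx.trans hy.symm) : y e ≠ none)
    have hext : Extends (assign x e i) y := by
      intro a ha
      by_cases hae : a = e
      · subst hae; simp [assign, hi]
      · simp only [assign, Function.update_of_ne hae] at ha ⊢
        exact h a ha
    have hcard : (Finset.univ.filter fun a => assign x e i a ≠ y a) =
        (Finset.univ.filter fun a => x a ≠ y a).erase e := by
      ext a
      rw [Finset.mem_erase, Finset.mem_filter, Finset.mem_filter]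
      by_cases hae : a = e
      · subst hae; simp [assign, hi]
      · simp [assign, hae]
    have h1 := ih hext (by rw [hcard, Finset.card_erase_of_mem he]; omega)
    have h2 := hf x e i (by simp [support, hx])
    unfold marginalGain at h2
    linarith

/-! ### Matroid exchange -/

/-- For `e ∉ B`, grow `insert e I` to a base `B'` inside its union with `B`. Some `b ∈ B` is missing
from `B'`, and exchanging it for an element of `B' \ B` leaves only `e` as a candidate. -/
theorem _root_.Matroid.IsBase.exists_exchange_of_indep_insert {α : Type*} {𝓜 : Matroid α}
    {B I : Set α} {e : α} (hB : 𝓜.IsBase B) (hI : I ⊆ B) (heI : e ∉ I)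
    (hins : 𝓜.Indep (insert e I)) : ∃ b ∈ B \ I, 𝓜.IsBase (insert e (B \ {b})) := by
  by_cases he : e ∈ B
  · exact ⟨e, ⟨he, heI⟩, by rwa [Set.insert_sdiff_singleton, Set.insert_eq_of_mem he]⟩
  obtain ⟨B', hB', h1, h2⟩ := hins.exists_isBase_subset_union_isBase hB
  obtain ⟨b, ⟨hbB, hbB'⟩, -⟩ := hB'.exchange hB ⟨h1 (Set.mem_insert e I), he⟩
  obtain ⟨a, ⟨haB', haB⟩, hbase⟩ := hB.exchange hB' ⟨hbB, hbB'⟩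
  have hae : a = e := by
    rcases h2 haB' with (rfl | h) | h
    · rfl
    · exact absurd (hI h) haB
    · exact absurd h haB
  exact ⟨b, ⟨hbB, fun h => hbB' (h1 (Set.mem_insert_of_mem e h))⟩, hae ▸ hbase⟩

/-! ### Algorithms with an approximate oracle -/

/-- Run with an oracle for `f` that is exact up to `ε`, the algorithm makes at most `q` queries and
returns an element satisfying `Q`. -/
def OracleAlg.Ensures {X : Type} (f : X → ℝ) (ε : ℝ) (Q : X → Prop) :
    OracleAlg X → ℕ → Prop
  | .ret S, _ => Q S
  | .query _ _, 0 => False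
  | .query A next, q + 1 => ∀ y, |y - f A| ≤ ε → (next y).Ensures f ε Q q

theorem OracleAlg.Ensures.mono {X : Type} {f : X → ℝ} {ε : ℝ} {Q : X → Prop}
    {alg : OracleAlg X} {q q' : ℕ} (h : alg.Ensures f ε Q q) (hq : q ≤ q') :
    alg.Ensures f ε Q q' := by
  induction alg generalizing q q' with
  | ret S => exact h
  | query A next ih =>
    match q, q', h, hq with
    | q + 1, q' + 1, h, hq => exact fun y hy => ih y (h y hy) (by omega)

theorem OracleAlg.Ensures.imp {X : Type} {f : X → ℝ} {ε : ℝ} {Q Q' : X → Prop}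
    (hQ : ∀ S, Q S → Q' S) {alg : OracleAlg X} {q : ℕ} (h : alg.Ensures f ε Q q) :
    alg.Ensures f ε Q' q := by
  induction alg generalizing q with
  | ret S => exact hQ S h
  | query A next ih =>
    match q, h with
    | q + 1, h => exact fun y hy => ih y (h y hy)

/-- While the algorithm is running, round `j * m` opens the block of its `j`-th query, so accurate
block means are admissible oracle answers. After an early return the remaining blocks play the
returned action. -/
theorem OracleAlg.Ensures.cetcAction {X : Type} {f : X → ℝ} {ε : ℝ} {Q : X → Prop} {m : ℕ}
    (hm : 0 < m) {q : ℕ} {alg : OracleAlg X} (h : alg.Ensures f ε Q q) (F : ℕ → X → ℝ)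
    (hF : ∀ j < q, |(∑ s ∈ Finset.range m, F (s + j * m) (alg.cetcAction m F (j * m))) / m -
      f (alg.cetcAction m F (j * m))| ≤ ε) {t : ℕ} (ht : q * m ≤ t) :
    Q (alg.cetcAction m F t) := by
  induction q generalizing alg F t with
  | zero =>
    cases alg with
    | ret S => exact h
    | query A next => exact h.elim
  | succ q ih =>
    cases alg with
    | ret S => exact h
    | query A next =>
      have ht' : m + q * m ≤ t := by linarith [Nat.succ_mul q m]
      have h0 := hF 0 (by omega)
      simp only [OracleAlg.cetcAction, zero_mul, hm, if_true, add_zero] at h0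
      rw [OracleAlg.cetcAction, if_neg (by omega)]
      refine ih (h _ h0) _ (fun j hj => ?_) (by omega)
      have hj' := hF (j + 1) (by omega)
      have e1 : ¬ (j + 1) * m < m := by rw [Nat.succ_mul]; omega
      have e2 : (j + 1) * m - m = j * m := by rw [Nat.succ_mul]; omega
      have e3 : ∀ s, s + (j + 1) * m = s + j * m + m := fun s => by ring
      simp only [OracleAlg.cetcAction, if_neg e1, e2, e3] at hj'
      exact hj'

/-- The disjunction is the induction invariant: an entry of the table will be accurate because its
pair is still to be queried, or because it already is. -/
theorem queryAll_ensures {n k : ℕ} {f : Assignment n k → ℝ} {ε : ℝ} {Q : Assignment n k → Prop}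
    {s : Assignment n k} {c : (Fin n × Fin k → ℝ) → OracleAlg (Assignment n k)} {q : ℕ}
    (L : List (Fin n × Fin k)) (v : Fin n × Fin k → ℝ)
    (hc : ∀ w, (∀ p, p ∈ L ∨ |v p - f (assign s p.1 p.2)| ≤ ε →
      |w p - f (assign s p.1 p.2)| ≤ ε) → (c w).Ensures f ε Q q) :
    (queryAll s c L v).Ensures f ε Q (L.length + q) := by
  induction L generalizing v with
  | nil =>
    rw [List.length_nil, zero_add]
    exact hc v (fun p hp => by simpa using hp)
  | cons p L ih =>
    rw [List.length_cons, Nat.add_right_comm]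
    intro y hy
    refine ih _ (fun w hw => hc w (fun p' hp' => hw p' ?_))
    by_cases hpp : p' = p
    · subst hpp
      right
      simpa using hy
    · simpa [hpp] using hp'

theorem GreedyRule.length_order_le {n k : ℕ} {𝓜 : Matroid (Fin n)} (rule : GreedyRule k 𝓜)
    (s : Assignment n k) : (rule.order s).length ≤ n * k := by
  simpa using (rule.order_nodup s).length_le_card

theorem greedyFrom_ensures {n k : ℕ} {𝓜 : Matroid (Fin n)} (rule : GreedyRule k 𝓜)
    {f : Assignment n k → ℝ} (hsub : IsKSubmodular f) (hmono : IsMonotone f) {ε : ℝ} {r : ℕ}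
    {s o : Assignment n k} (hso : Extends s o) (ho : 𝓜.IsBase (support o))
    (hr : (support s).encard + r = 𝓜.eRank) :
    (greedyFrom rule r s).Ensures f ε (fun S => f o + f s ≤ 2 * f S + 2 * r * ε)
      (r * (n * k)) := by
  induction r generalizing s o with
  | zero =>
    have : support s = support o :=
      (Set.toFinite (support s)).eq_of_subset_of_encard_le hso.support_subset
        (by rw [ho.encard_eq_eRank, ← hr]; simp)
    have : s = o := hso.eq_of_support_subset this.ge
    subst this
    simp only [greedyFrom, OracleAlg.Ensures]
    push_cast
    linarith
  | succ r ih =>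
    have havail : ∀ b ∈ support o \ support s, b ∈ available 𝓜 s := fun b hb =>
      ⟨hb.2, ho.indep.subset (Set.insert_subset hb.1 hso.support_subset)⟩
    have hne : rule.order s ≠ [] := by
      obtain ⟨b, hb⟩ : (support o \ support s).Nonempty := by
        rw [Set.sdiff_nonempty]
        intro hsub'
        have heq : support s = support o := hso.support_subset.antisymm hsub'
        rw [heq, ← ho.encard_eq_eRank] at hr
        have hfin := (Set.toFinite (support o)).encard_lt_top.ne
        lift (support o).encard to ℕ using hfin with a
        norm_cast at hr
        omega
      obtain ⟨i, -⟩ := Option.ne_none_iff_exists'.1 hb.1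
      exact List.ne_nil_of_mem ((rule.mem_order s (b, i)).2 (havail b hb))
    refine OracleAlg.Ensures.mono (q := (rule.order s).length + r * (n * k)) ?_
      (by rw [Nat.succ_mul]; linarith [rule.length_order_le s])
    refine queryAll_ensures _ _ (fun w hw => ?_)
    obtain ⟨⟨e, i⟩, hp, hsel, hmax⟩ := rule.select_spec s w hne
    have hpav := (rule.mem_order s _).1 hp
    rw [hsel]
    obtain ⟨b, hb, hbase⟩ :=
      ho.exists_exchange_of_indep_insert hso.support_subset hpav.1 hpav.2
    obtain ⟨i', hi'⟩ := Option.ne_none_iff_exists'.1 hb.1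
    have hbs : s b = none := by simpa [support] using hb.2
    have hes : s e = none := by simpa [support] using hpav.1
    set o' := Function.update o b none with ho'
    have ho's : support o' = support o \ {b} := support_update_none o b
    have hoo' : assign o' b i' = o := by
      rw [assign, ho', Function.update_idem, ← hi', Function.update_eq_self]
    have hso' : Extends s o' := by
      intro a ha
      have : a ≠ b := by rintro rfl; exact ha hbs
      rw [ho', Function.update_of_ne this]
      exact hso a ha
    have h1 : f o - f o' ≤ f (assign s b i') - f s := by
      have := hsub.marginalGain_le_of_extends hso' (e := b) (by simp [ho's]) i'
      rwa [marginalGain, marginalGain, hoo'] at this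
    -- If `e` already had a type in `o'`, the exchanged set would be a base properly contained in
    -- the base `support o`.
    have hext : Extends o' (assign o' e i) := by
      intro a ha
      by_cases hae : a = e
      · subst hae
        by_contra
        have hne' : a ∈ support o' := ha
        have hnb : a ≠ b := by
          rintro rfl
          simp [ho's] at hne'
        have : insert a (support o \ {b}) = support o \ {b} :=
          Set.insert_eq_of_mem (ho's ▸ hne')
        rw [this] at hbase
        exact (hbase.eq_of_subset_isBase ho Set.sdiff_subset ▸ hb.1).2 rfl
      · simp [assign, hae]
    have h2 : f o' ≤ f (assign o' e i) := hmono.le_of_extends hext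
    -- Two oracle values are compared, each off by at most `ε`.
    have h3 : f (assign s b i') ≤ f (assign s e i) + 2 * ε := by
      have hq : (b, i') ∈ rule.order s := (rule.mem_order s _).2 (havail b hb)
      have a1 := abs_le.1 (hw (b, i') (Or.inl hq))
      have a2 := abs_le.1 (hw (e, i) (Or.inl hp))
      have a3 := hmax _ hq
      dsimp only at a1 a2
      linarith [a1.1, a2.2]
    have hstep := ih (s := assign s e i) (o := assign o' e i)
      (by
        intro a ha
        by_cases hae : a = e
        · subst hae; simp [assign]
        · simp only [assign, Function.update_of_ne hae] at ha ⊢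
          exact hso' a ha)
      (by rw [support_assign, ho's]; exact hbase)
      (by
        rw [support_assign, Set.encard_insert_of_notMem hpav.1, ← hr]
        push_cast
        ring)
    have hweak : ∀ S, f (assign o' e i) + f (assign s e i) ≤ 2 * f S + 2 * r * ε →
        f o + f s ≤ 2 * f S + 2 * (r + 1 : ℕ) * ε := by
      intro S hS
      push_cast
      linarith
    exact OracleAlg.Ensures.imp hweak hstep

/-! ### Measurability of the actions of C-ETC -/

/-- The actions of a family of algorithms depend measurably on the index and on the rewards. -/
def MeasurableFamily {X Z : Type} [MeasurableSpace Z] (alg : Z → OracleAlg X) : Prop :=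
  ∀ (m t : ℕ) (a : X),
    MeasurableSet {w : Z × (ℕ → X → ℝ) | (alg w.1).cetcAction m w.2 t = a}

theorem MeasurableFamily.ret {X Z : Type} [MeasurableSpace Z] (S : X) :
    MeasurableFamily fun _ : Z => OracleAlg.ret S :=
  fun _ _ a => MeasurableSet.const (S = a)

theorem MeasurableFamily.comp {X Z W : Type} [MeasurableSpace Z] [MeasurableSpace W]
    {alg : Z → OracleAlg X} (h : MeasurableFamily alg) {g : W → Z} (hg : Measurable g) :
    MeasurableFamily fun w => alg (g w) := by
  intro m t a
  have hmeas : Measurable fun w : W × (ℕ → X → ℝ) => (g w.1, w.2) := by fun_prop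
  exact hmeas (h m t a)

/-- The answer joins the index and the rewards are shifted by one block; this is why families, not
single algorithms, are treated. -/
theorem MeasurableFamily.query {X Z : Type} [MeasurableSpace Z] (A : X)
    {next : Z → ℝ → OracleAlg X} (h : MeasurableFamily fun w : Z × ℝ => next w.1 w.2) :
    MeasurableFamily fun z => OracleAlg.query A (next z) := by
  intro m t a
  simp only [OracleAlg.cetcAction]
  by_cases ht : t < m
  · simp only [ht, if_true]
    exact MeasurableSet.const (A = a)
  · simp only [ht, if_false]
    have hmeas : Measurable fun w : Z × (ℕ → X → ℝ) =>
        (((w.1, (∑ s ∈ Finset.range m, w.2 s A) / (m : ℝ)), fun s => w.2 (s + m)) :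
          (Z × ℝ) × (ℕ → X → ℝ)) := by
      fun_prop
    exact hmeas (h m (t - m) a)

theorem MeasurableFamily.cases {X Z ι : Type} [MeasurableSpace Z] [Countable ι]
    {alg : ι → OracleAlg X} {g : Z → ι} (hg : ∀ i, MeasurableSet {z | g z = i})
    (h : ∀ i, MeasurableFamily fun _ : Z => alg i) :
    MeasurableFamily fun z => alg (g z) := by
  intro m t a
  have : {w : Z × (ℕ → X → ℝ) | (alg (g w.1)).cetcAction m w.2 t = a} =
      ⋃ i, (Prod.fst ⁻¹' {z | g z = i}) ∩ {w | (alg i).cetcAction m w.2 t = a} := by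
    ext w
    simp
  rw [this]
  exact MeasurableSet.iUnion fun i => (measurable_fst (hg i)).inter (h i m t a)

theorem measurableFamily_queryAll {n k : ℕ} (s : Assignment n k)
    {c : (Fin n × Fin k → ℝ) → OracleAlg (Assignment n k)} (hc : MeasurableFamily c)
    (L : List (Fin n × Fin k)) : MeasurableFamily fun v => queryAll s c L v := by
  induction L with
  | nil => exact hc
  | cons p L ih =>
    refine MeasurableFamily.query (assign s p.1 p.2)
      (MeasurableFamily.comp ih 
        (g := fun w : (Fin n × Fin k → ℝ) × ℝ => Function.update w.1 p w.2) ?_)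
    rw [measurable_pi_iff]
    intro a
    by_cases ha : a = p
    · subst ha
      simpa using measurable_snd
    · simp only [Function.update_of_ne ha]
      fun_prop

theorem measurableFamily_greedyFrom {n k : ℕ} {𝓜 : Matroid (Fin n)} (rule : GreedyRule k 𝓜)
    {Z : Type} [MeasurableSpace Z] (r : ℕ) (s : Assignment n k) :
    MeasurableFamily fun _ : Z => greedyFrom rule r s := by
  induction r generalizing s Z with
  | zero => exact MeasurableFamily.ret s
  | succ r ih =>
    refine MeasurableFamily.comp (g := fun _ : Z => (0 : Fin n × Fin k → ℝ))
      (measurableFamily_queryAll s (MeasurableFamily.cases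
        (alg := fun p => match p with
          | some p => greedyFrom rule r (assign s p.1 p.2)
          | none => .ret s)
        (rule.measurableSet_select s) ?_) (rule.order s)) measurable_const
    rintro (_ | p)
    · exact MeasurableFamily.ret s
    · exact ih _

theorem measurableSet_greedyCETC {n k : ℕ} {𝓜 : Matroid (Fin n)} (rule : GreedyRule k 𝓜)
    (M T t : ℕ) (a : Assignment n k) :
    MeasurableSet {F : ℕ → Assignment n k → ℝ | greedyCETC rule M T F t = a} := by
  have hmeas : Measurable fun F : ℕ → Assignment n k → ℝ => ((), F) := by fun_prop
  exact hmeas (measurableFamily_greedyFrom (Z := Unit) rule M (fun _ => none) _ t a)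

theorem OracleAlg.cetcAction_congr {X : Type} {m : ℕ} {alg : OracleAlg X}
    {F G : ℕ → X → ℝ} {t : ℕ} (h : ∀ s < t, F s = G s) :
    alg.cetcAction m F t = alg.cetcAction m G t := by
  induction alg generalizing F G t with
  | ret S => rfl
  | query A next ih =>
    simp only [OracleAlg.cetcAction]
    split_ifs with ht
    · rfl
    · have : ∑ s ∈ Finset.range m, F s A = ∑ s ∈ Finset.range m, G s A :=
        Finset.sum_congr rfl fun s hs => by
          rw [h s (by have := Finset.mem_range.1 hs; omega)]
      rw [this]
      exact ih _ fun s hs => h _ (by omega)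

/-! ### Adaptive actions and independent rewards -/

/-- A rule that chooses an action in each round from the rewards of the earlier rounds. -/
structure IsPolicy {X : Type} (act : (ℕ → X → ℝ) → ℕ → X) : Prop where
  measurableSet : ∀ t a, MeasurableSet {F | act F t = a}
  congr : ∀ (F G : ℕ → X → ℝ) (t : ℕ), (∀ s < t, F s = G s) → act F t = act G t

theorem isPolicy_greedyCETC {n k : ℕ} {𝓜 : Matroid (Fin n)} (rule : GreedyRule k 𝓜) (M T : ℕ) :
    IsPolicy (greedyCETC rule M T) where
  measurableSet := measurableSet_greedyCETC rule M T
  congr _ _ _ h := OracleAlg.cetcAction_congr h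

section Policy

variable {Ω X : Type*} [MeasurableSpace Ω] {P : Measure Ω} {F : ℕ → Ω → X → ℝ}

theorem IsRewardProcess.integral_eq (hF : IsRewardProcess P F) (t : ℕ) (a : X) :
    ∫ ω, F t ω a ∂P = expectedReward P F a :=
  ((hF.identDistrib t).comp (u := fun g : X → ℝ => g a) (measurable_pi_apply a)).integral_eq

theorem IsRewardProcess.measurable_apply (hF : IsRewardProcess P F) (t : ℕ) (a : X) :
    Measurable fun ω => F t ω a :=
  (measurable_pi_apply a).comp (hF.measurable t)

theorem IsRewardProcess.expectedReward_mem_Icc [IsProbabilityMeasure P]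
    (hF : IsRewardProcess P F) (a : X) : expectedReward P F a ∈ Set.Icc (0 : ℝ) 1 := by
  have h := hF.mem_Icc 0 a
  refine ⟨integral_nonneg_of_ae (h.mono fun ω hω => hω.1), ?_⟩
  have hint : Integrable (fun ω => F 0 ω a) P :=
    Integrable.of_mem_Icc 0 1 (hF.measurable_apply 0 a).aemeasurable h
  calc expectedReward P F a ≤ ∫ _, (1 : ℝ) ∂P :=
        integral_mono_ae hint (integrable_const 1) (h.mono fun ω hω => hω.2)
    _ = 1 := by simp

theorem IsRewardProcess.hoeffding [IsProbabilityMeasure P] (hF : IsRewardProcess P F) (a : X)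
    {m : ℕ} (hm : 0 < m) (b : ℕ) {ε : ℝ} (hε : 0 ≤ ε) :
    P.real {ω | ε < |(∑ s ∈ Finset.range m, F (s + b) ω a) / m - expectedReward P F a|} ≤
      2 * Real.exp (-2 * m * ε ^ 2) := by
  have hm' : (0 : ℝ) < m := by exact_mod_cast hm
  have hind : iIndepFun (fun s ω => F (s + b) ω a - expectedReward P F a) P :=
    (hF.indep.precomp (add_left_injective b)).comp (fun _ g => g a - expectedReward P F a)
      (fun _ => by fun_prop)
  -- The parameter `1 / 4` is the squared half-length of `[0, 1]`.
  have hsub : ∀ s < m, HasSubgaussianMGF (fun ω => F (s + b) ω a - expectedReward P F a)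
      (1 / 4) P := by
    intro s _
    have := hasSubgaussianMGF_of_mem_Icc (hF.measurable_apply (s + b) a).aemeasurable
      (hF.mem_Icc (s + b) a)
    rw [hF.integral_eq] at this
    convert this using 1
    ext
    norm_num
  have hexp : Real.exp (-(m * ε) ^ 2 / (2 * m * ((1 / 4 : NNReal) : ℝ))) =
      Real.exp (-2 * m * ε ^ 2) := by
    congr 1
    push_cast
    field_simp
    ring
  have h1 := HasSubgaussianMGF.measure_sum_range_ge_le_of_iIndepFun hind hsub
    (ε := m * ε) (by positivity)
  have h2 := HasSubgaussianMGF.measure_sum_range_ge_le_of_iIndepFun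
    (X := fun s ω => -(F (s + b) ω a - expectedReward P F a))
    (hind.comp (fun _ x => -x) (fun _ => measurable_neg))
    (fun s hs => (hsub s hs).neg) (ε := m * ε) (by positivity)
  rw [hexp] at h1 h2
  calc _ ≤ P.real ({ω | m * ε ≤ ∑ s ∈ Finset.range m, (F (s + b) ω a - expectedReward P F a)} ∪
        {ω | m * ε ≤ ∑ s ∈ Finset.range m, -(F (s + b) ω a - expectedReward P F a)}) := by
        refine measureReal_mono fun ω hω => ?_
        simp only [Set.mem_ofPred_eq] at hω
        simp only [Set.mem_union, Set.mem_ofPred_eq, Finset.sum_neg_distrib,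
          Finset.sum_sub_distrib, Finset.sum_const, Finset.card_range, nsmul_eq_mul]
        rw [div_sub' hm'.ne', abs_div, abs_of_pos hm', lt_div_iff₀ hm'] at hω
        rcases lt_abs.1 hω with h | h
        · left; linarith
        · right; linarith
    _ ≤ _ := (measureReal_union_le _ _).trans (by linarith)

end Policy

section Adaptive

variable {Ω : Type*} {X : Type} [MeasurableSpace Ω] {P : Measure Ω} {F : ℕ → Ω → X → ℝ}
  {act : (ℕ → X → ℝ) → ℕ → X}

theorem IsPolicy.measurableSet_comp (hact : IsPolicy act) (hF : IsRewardProcess P F) (t : ℕ)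
    (a : X) : MeasurableSet {ω | act (fun s => F s ω) t = a} := by
  have hmeas : Measurable fun ω => (fun s => F s ω) := measurable_pi_iff.2 hF.measurable
  exact hmeas (hact.measurableSet t a)

/-- The action of round `t` is independent of the rewards from round `t` on. -/
theorem IsPolicy.indepFun (hact : IsPolicy act) (hF : IsRewardProcess P F) {t : ℕ} (a : X)
    {U : Finset ℕ} (hU : ∀ s ∈ U, t ≤ s) :
    IndepFun ({ω | act (fun s => F s ω) t = a}.indicator (1 : Ω → ℝ))
      (fun ω (i : U) => F i ω) P := by
  have hdisj : Disjoint (Finset.range t) U := by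
    rw [Finset.disjoint_left]
    intro s hs hsU
    have := Finset.mem_range.1 hs
    have := hU s hsU
    omega
  have h := hF.indep.indepFun_finset (Finset.range t) U hdisj hF.measurable
  -- Padding the first `t` rewards with zeros leaves the action of round `t` unchanged, so that
  -- action is a function of those rewards alone.
  let ext : ((i : Finset.range t) → X → ℝ) → ℕ → X → ℝ :=
    fun g s => if hs : s ∈ Finset.range t then g ⟨s, hs⟩ else 0
  have hext : Measurable ext := by
    refine measurable_pi_iff.2 fun s => ?_
    by_cases hs : s ∈ Finset.range t
    · simp only [ext, hs, dif_pos]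
      exact measurable_pi_apply _
    · simp only [ext, hs, dif_neg, not_false_eq_true]
      exact measurable_const
  have hφ : Measurable
      ((ext ⁻¹' {G | act G t = a}).indicator (1 : ((i : Finset.range t) → X → ℝ) → ℝ)) :=
    measurable_one.indicator (hext (hact.measurableSet t a))
  have heq : ∀ ω, act (ext fun i => F i ω) t = act (fun s => F s ω) t := fun ω =>
    hact.congr _ _ _ fun s hs => by simp [ext, hs]
  have hcomp := h.comp hφ measurable_id
  have hset : (fun ω (i : Finset.range t) => F i ω) ⁻¹' (ext ⁻¹' {G | act G t = a}) =
      {ω | act (fun s => F s ω) t = a} := by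
    ext ω
    exact Eq.congr_left (heq ω)
  rw [← hset]
  exact hcomp

/-- Split according to the finitely many values of the action: each indicator is independent of the
reward of round `t`, which can thus be replaced by its mean. -/
theorem IsPolicy.integral_reward [Fintype X] [IsProbabilityMeasure P] (hact : IsPolicy act)
    (hF : IsRewardProcess P F) (t : ℕ) :
    Integrable (fun ω => F t ω (act (fun s => F s ω) t)) P ∧
    Integrable (fun ω => expectedReward P F (act (fun s => F s ω) t)) P ∧
    ∫ ω, F t ω (act (fun s => F s ω) t) ∂P =
      ∫ ω, expectedReward P F (act (fun s => F s ω) t) ∂P := by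
  classical
  let I : X → Ω → ℝ := fun a => {ω | act (fun s => F s ω) t = a}.indicator 1
  have hI : ∀ a, Measurable (I a) := fun a =>
    measurable_one.indicator (hact.measurableSet_comp hF t a)
  have hIint : ∀ a, Integrable (I a) P := fun a =>
    (integrable_const (1 : ℝ)).indicator (hact.measurableSet_comp hF t a)
  have hsum : ∀ (g : Ω → X → ℝ) ω, g ω (act (fun s => F s ω) t) = ∑ a, I a ω * g ω a := by
    intro g ω
    simp [I, Set.indicator]
  have hFint : ∀ a, Integrable (fun ω => F t ω a) P := fun a =>
    Integrable.of_mem_Icc 0 1 (hF.measurable_apply t a).aemeasurable (hF.mem_Icc t a)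
  have hind : ∀ a, IndepFun (I a) (fun ω => F t ω a) P := fun a =>
    (hact.indepFun hF a (U := {t}) (by simp)).comp (φ := id)
      (ψ := fun g : ((i : ({t} : Finset ℕ)) → X → ℝ) => g ⟨t, by simp⟩ a) measurable_id
      (by fun_prop)
  have hprod : ∀ a, Integrable (fun ω => I a ω * F t ω a) P := fun a =>
    (hind a).integrable_mul (hIint a) (hFint a)
  have hprod' : ∀ a, Integrable (fun ω => I a ω * expectedReward P F a) P := fun a =>
    (hIint a).mul_const _
  simp_rw [hsum (fun ω => F t ω), hsum (fun _ => expectedReward P F)]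
  refine ⟨integrable_finsetSum _ fun a _ => hprod a, integrable_finsetSum _ fun a _ => hprod' a, ?_⟩
  rw [integral_finsetSum _ fun a _ => hprod a, integral_finsetSum _ fun a _ => hprod' a]
  refine Finset.sum_congr rfl fun a _ => ?_
  rw [(hind a).integral_fun_mul_eq_mul_integral (hI a).aestronglyMeasurable
    (hFint a).aestronglyMeasurable, hF.integral_eq, integral_mul_const]

/-- The mean reward of an action chosen before a block of `m` rounds deviates by more than `ε`
from the expected reward. -/
def deviation (P : Measure Ω) (F : ℕ → Ω → X → ℝ) (act : (ℕ → X → ℝ) → ℕ → X) (m : ℕ) (ε : ℝ)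
    (t : ℕ) : Set Ω :=
  {ω | ε < |(∑ s ∈ Finset.range m, F (s + t) ω (act (fun s => F s ω) t)) / m -
    expectedReward P F (act (fun s => F s ω) t)|}

theorem deviation_eq_iUnion (m : ℕ) (ε : ℝ) (t : ℕ) :
    deviation P F act m ε t = ⋃ a, {ω | act (fun s => F s ω) t = a} ∩
      {ω | ε < |(∑ s ∈ Finset.range m, F (s + t) ω a) / m - expectedReward P F a|} := by
  ext ω
  simp [deviation]

theorem IsRewardProcess.measurableSet_deviation (hF : IsRewardProcess P F) (a : X) (m : ℕ)
    (ε : ℝ) (t : ℕ) : MeasurableSet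
      {ω | ε < |(∑ s ∈ Finset.range m, F (s + t) ω a) / m - expectedReward P F a|} := by
  have := hF.measurable_apply
  refine measurableSet_lt measurable_const ?_
  fun_prop

theorem IsPolicy.measurableSet_deviation [Countable X] (hact : IsPolicy act)
    (hF : IsRewardProcess P F) (m : ℕ) (ε : ℝ) (t : ℕ) :
    MeasurableSet (deviation P F act m ε t) := by
  rw [deviation_eq_iUnion]
  exact MeasurableSet.iUnion fun a =>
    (hact.measurableSet_comp hF t a).inter (hF.measurableSet_deviation a m ε t)

/-- Hoeffding is applied on each event "the action is `a`", weighted by its probability. The weights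
sum to one, so the number of actions does not enter. -/
theorem IsPolicy.measureReal_deviation_le [Fintype X] [IsProbabilityMeasure P]
    (hact : IsPolicy act) (hF : IsRewardProcess P F) {m : ℕ} (hm : 0 < m) {ε : ℝ} (hε : 0 ≤ ε)
    (t : ℕ) : P.real (deviation P F act m ε t) ≤ 2 * Real.exp (-2 * m * ε ^ 2) := by
  rw [deviation_eq_iUnion]
  have hind : ∀ a, P.real ({ω | act (fun s => F s ω) t = a} ∩
      {ω | ε < |(∑ s ∈ Finset.range m, F (s + t) ω a) / m - expectedReward P F a|}) ≤
      P.real {ω | act (fun s => F s ω) t = a} * (2 * Real.exp (-2 * m * ε ^ 2)) := by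
    intro a
    let U : Finset ℕ := (Finset.range m).map (addRightEmbedding t)
    have hU : ∀ s ∈ Finset.range m, s + t ∈ U := fun s hs => by simpa [U] using hs
    have h := hact.indepFun hF a (t := t) (U := U) (by simp [U])
    let dev : ((i : U) → X → ℝ) → ℝ := fun g =>
      |(∑ s : Finset.range m, g ⟨s + t, hU s s.2⟩ a) / m - expectedReward P F a|
    have hdev : Measurable dev := by fun_prop
    have hset : MeasurableSet {g | ε < dev g} := measurableSet_lt measurable_const hdev
    have := h.measure_inter_preimage_eq_mul {1} {g | ε < dev g} (measurableSet_singleton 1) hset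
    have e1 : ({ω | act (fun s => F s ω) t = a}.indicator (1 : Ω → ℝ)) ⁻¹' {1} =
        {ω | act (fun s => F s ω) t = a} := by
      ext ω
      simp [Set.indicator]
    have e2 : (fun ω (i : U) => F i ω) ⁻¹' {g | ε < dev g} =
        {ω | ε < |(∑ s ∈ Finset.range m, F (s + t) ω a) / m - expectedReward P F a|} := by
      ext ω
      simp only [Set.mem_preimage, Set.mem_ofPred_eq, dev]
      rw [Finset.sum_coe_sort (Finset.range m) (fun s => F (s + t) ω a)]
    rw [e1, e2] at this
    rw [measureReal_def, this, ENNReal.toReal_mul]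
    exact mul_le_mul_of_nonneg_left (hF.hoeffding a hm t hε) ENNReal.toReal_nonneg
  have htotal : ∑ a, P.real {ω | act (fun s => F s ω) t = a} = 1 := by
    rw [← measureReal_biUnion_finset (fun a _ b _ hab => ?_)
      (fun a _ => hact.measurableSet_comp hF t a)]
    · have : ⋃ a ∈ Finset.univ, {ω | act (fun s => F s ω) t = a} = Set.univ := by
        ext ω; simp
      rw [this, probReal_univ]
    · exact Set.disjoint_left.2 fun ω h1 h2 => hab (h1.symm.trans h2)
  calc _ ≤ ∑ a, P.real ({ω | act (fun s => F s ω) t = a} ∩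
        {ω | ε < |(∑ s ∈ Finset.range m, F (s + t) ω a) / m - expectedReward P F a|}) :=
        measureReal_iUnion_fintype_le _
    _ ≤ ∑ a, P.real {ω | act (fun s => F s ω) t = a} * (2 * Real.exp (-2 * m * ε ^ 2)) :=
        Finset.sum_le_sum fun a _ => hind a
    _ = 2 * Real.exp (-2 * m * ε ^ 2) := by rw [← Finset.sum_mul, htotal, one_mul]

end Adaptive

/-! ### Regret of explore-then-commit -/

/-- If a policy earns at least `V - δ` per round in expectation after `q` blocks of `m` rounds
without an `ε`-deviation, its total reward falls short of `V` per round by at most `q * m` for the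
blocks, `δ` per round, and the probability of a deviation per round. -/
theorem IsPolicy.regret_le {Ω : Type*} {X : Type} [Fintype X] [MeasurableSpace Ω] {P : Measure Ω}
    [IsProbabilityMeasure P] {F : ℕ → Ω → X → ℝ} {act : (ℕ → X → ℝ) → ℕ → X}
    (hact : IsPolicy act) (hF : IsRewardProcess P F) {m : ℕ} (hm : 0 < m) {ε δ V : ℝ}
    (hε : 0 ≤ ε) (hδ : 0 ≤ δ) (hV : V ≤ 1) (q T : ℕ)
    (hgood : ∀ ω, (∀ j < q, ω ∉ deviation P F act m ε (j * m)) → ∀ t, q * m ≤ t →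
      V - δ ≤ expectedReward P F (act (fun s => F s ω) t)) :
    V * T - ∫ ω, ∑ t ∈ Finset.range T, F t ω (act (fun s => F s ω) t) ∂P ≤
      q * m + T * δ + T * (q * (2 * Real.exp (-2 * m * ε ^ 2))) := by
  classical
  set B : Set Ω := ⋃ j ∈ Finset.range q, deviation P F act m ε (j * m) with hB
  have hBmeas : MeasurableSet B :=
    Finset.measurableSet_biUnion _ fun j _ => hact.measurableSet_deviation hF m ε (j * m)
  have hBprob : P.real B ≤ q * (2 * Real.exp (-2 * m * ε ^ 2)) := by
    calc P.real B ≤ ∑ j ∈ Finset.range q, P.real (deviation P F act m ε (j * m)) :=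
          measureReal_biUnion_finset_le _ _
      _ ≤ ∑ j ∈ Finset.range q, 2 * Real.exp (-2 * m * ε ^ 2) :=
          Finset.sum_le_sum fun j _ => hact.measureReal_deviation_le hF hm hε _
      _ = q * (2 * Real.exp (-2 * m * ε ^ 2)) := by simp
  -- A round costs at most `1` because `V ≤ 1` and rewards have nonnegative mean. After the blocks
  -- this full cost is charged only on `B`.
  have hround : ∀ t, V - ∫ ω, F t ω (act (fun s => F s ω) t) ∂P ≤
      (if t < q * m then 1 else 0) + (δ + P.real B) := by
    intro t
    obtain ⟨-, hint, heq⟩ := hact.integral_reward hF t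
    have hBint : Integrable (B.indicator (1 : Ω → ℝ)) P :=
      (integrable_const (1 : ℝ)).indicator hBmeas
    have hpt : ∀ ω, V - ((if t < q * m then 1 else 0) + δ) ≤
        expectedReward P F (act (fun s => F s ω) t) + B.indicator (1 : Ω → ℝ) ω := by
      intro ω
      have h0 := (hF.expectedReward_mem_Icc (act (fun s => F s ω) t)).1
      have h1 : 0 ≤ B.indicator (1 : Ω → ℝ) ω := Set.indicator_nonneg (by simp) ω
      split_ifs with ht
      · linarith
      · by_cases hω : ω ∈ B
        · rw [Set.indicator_of_mem hω, Pi.one_apply]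
          linarith
        · have := hgood ω (fun j hj h => hω (Set.mem_biUnion (Finset.mem_range.2 hj) h)) t
            (by omega)
          linarith
    have := integral_mono (integrable_const _) (hint.add hBint) hpt
    simp only [integral_const, probReal_univ, one_smul, Pi.add_apply] at this
    rw [integral_add hint hBint, integral_indicator_one hBmeas, ← heq] at this
    linarith
  have hcount : ∑ t ∈ Finset.range T, (if t < q * m then (1 : ℝ) else 0) ≤ q * m := by
    rw [Finset.sum_ite, Finset.sum_const_zero, add_zero, Finset.sum_const, nsmul_eq_mul, mul_one]
    have : ((Finset.range T).filter fun t => t < q * m) ⊆ Finset.range (q * m) := fun t ht =>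
      Finset.mem_range.2 (Finset.mem_filter.1 ht).2
    exact_mod_cast (Finset.card_le_card this).trans (Finset.card_range _).le
  rw [integral_finsetSum _ fun t _ => (hact.integral_reward hF t).1]
  calc _ = ∑ t ∈ Finset.range T, (V - ∫ ω, F t ω (act (fun s => F s ω) t) ∂P) := by
        simp [Finset.sum_sub_distrib, mul_comm]
    _ ≤ ∑ t ∈ Finset.range T, ((if t < q * m then 1 else 0) + (δ + P.real B)) :=
        Finset.sum_le_sum fun t _ => hround t
    _ = ∑ t ∈ Finset.range T, (if t < q * m then (1 : ℝ) else 0) + T * (δ + P.real B) := by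
        rw [Finset.sum_add_distrib]; simp [mul_add]
    _ ≤ _ := by
        have : (T : ℝ) * P.real B ≤ T * (q * (2 * Real.exp (-2 * m * ε ^ 2))) := by gcongr
        linarith

/-- A feasible solution extends to one supported on a base. -/
theorem exists_extends_isBase {n k : ℕ} {𝓜 : Matroid (Fin n)} (hk : 0 < k)
    {x : Assignment n k} (hx : x ∈ feasible k 𝓜) :
    ∃ o, Extends x o ∧ 𝓜.IsBase (support o) := by
  classical
  obtain ⟨B, hB, hxB⟩ := Matroid.Indep.exists_isBase_superset hx
  refine ⟨fun e => if x e ≠ none then x e else if e ∈ B then some ⟨0, hk⟩ else none,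
    fun e he => if_pos he, ?_⟩
  convert hB
  ext e
  have : x e ≠ none → e ∈ B := fun h => hxB h
  simp only [support, Set.mem_ofPred_eq]
  grind

/-- Here `V = f OPT / 2`; halving the offline loss `2 M ε` gives `δ = M ε`, and the value of the
empty solution is dropped as nonnegative. -/
theorem greedyCETC_regret_le {n k M T : ℕ} {𝓜 : Matroid (Fin n)} (rule : GreedyRule k 𝓜)
    {Ω : Type*} [MeasurableSpace Ω] {P : Measure Ω} [IsProbabilityMeasure P]
    {F : ℕ → Ω → Assignment n k → ℝ} {OPT : Assignment n k} (hk : 0 < k)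
    (hrank : 𝓜.eRank = M) (hF : IsRewardProcess P F)
    (hsub : IsKSubmodular (expectedReward P F)) (hmono : IsMonotone (expectedReward P F))
    (hOPT : OPT ∈ feasible k 𝓜) {m : ℕ} (hm : m = cetcReps (M + 1) (n * k * M) T) (hm0 : 0 < m)
    {ε : ℝ} (hε : 0 ≤ ε) :
    expectedRegret P F (1 / 2) T OPT
        (fun t ω => greedyCETC rule M T (fun s => F s ω) t) ≤
      (n * k * M : ℝ) * m + T * (M * ε) +
        T * ((n * k * M : ℝ) * (2 * Real.exp (-2 * m * ε ^ 2))) := by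
  set f := expectedReward P F with hf
  have hOPT1 := hF.expectedReward_mem_Icc OPT
  obtain ⟨o, hext, hbase⟩ := exists_extends_isBase hk hOPT
  have hens := greedyFrom_ensures rule hsub hmono (ε := ε) (r := M) (s := fun _ => none)
    (fun e he => absurd rfl he) hbase (by simp [support, hrank])
  have h := (isPolicy_greedyCETC rule M T).regret_le hF hm0 hε (δ := M * ε)
    (V := 1 / 2 * f OPT) (by positivity) (by linarith [hOPT1.2]) (M * (n * k)) T ?_
  · unfold expectedRegret
    rw [← hf]
    push_cast at h
    linarith
  · intro ω hω t ht
    have h0 := (hF.expectedReward_mem_Icc (fun _ => none : Assignment n k)).1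
    have h1 := hmono.le_of_extends hext
    have h2 := hens.cetcAction hm0 (fun s => F s ω) (fun j hj => ?_) ht
    · have h3 : greedyCETC rule M T (fun s => F s ω) t =
          (greedyFrom rule M fun _ => none).cetcAction m (fun s => F s ω) t := by
        rw [hm]; rfl
      rw [h3]
      linarith
    · have := hω j hj
      simp only [deviation, Set.mem_ofPred_eq, not_lt, greedyCETC, ← hm] at this
      exact this

/-! ### The choice of parameters -/

theorem rpow_third_pow {x : ℝ} (hx : 0 ≤ x) : (x ^ (1 / 3 : ℝ)) ^ 3 = x := by
  rw [← Real.rpow_natCast, ← Real.rpow_mul hx]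
  norm_num

theorem rpow_two_thirds {x : ℝ} (hx : 0 ≤ x) : x ^ (2 / 3 : ℝ) = (x ^ (1 / 3 : ℝ)) ^ 2 := by
  rw [← Real.rpow_natCast, ← Real.rpow_mul hx]
  norm_num

/-- In terms of cube roots all estimates become polynomial. With `R = a b³ t² l` the three summands
are at most `3R`, `2R` and `4R`. -/
theorem parameter_bound {n k M T m : ℕ} (hn : 0 < n) (hk : 0 < k) (hM : 0 < M) (hT : 2 ≤ T)
    (hTnk : (n * k : ℝ) ≤ T) (hm : m = cetcReps (M + 1) (n * k * M) T) :
    0 < m ∧ (n * k * M : ℝ) * m + T * (M * √(Real.log T / m)) +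
        T * ((n * k * M : ℝ) * (2 * Real.exp (-2 * m * √(Real.log T / m) ^ 2))) ≤
      10 * (n : ℝ) ^ (1 / 3 : ℝ) * (k : ℝ) ^ (1 / 3 : ℝ) * M * (T : ℝ) ^ (2 / 3 : ℝ) *
        Real.log T ^ (1 / 3 : ℝ) := by
  have hT' : (2 : ℝ) ≤ T := by exact_mod_cast hT
  have hM1 : (1 : ℝ) ≤ M := by exact_mod_cast hM
  -- Gives `1 ≤ 2 * l`, which lets terms without a logarithm be absorbed into `R`.
  have hL2 : (1 / 8 : ℝ) ≤ Real.log T := by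
    have := Real.log_le_log (by norm_num) hT'
    linarith [Real.log_two_gt_d9]
  have hL0 : 0 < Real.log T := by linarith
  have hroot : ∀ {x : ℝ}, 0 < x → 0 < x ^ (1 / 3 : ℝ) := fun hx => Real.rpow_pos_of_pos hx _
  set L := Real.log T with hL
  obtain ⟨a, ha⟩ : ∃ a, a = ((n * k : ℝ)) ^ (1 / 3 : ℝ) := ⟨_, rfl⟩
  obtain ⟨b, hb⟩ : ∃ b, b = (M : ℝ) ^ (1 / 3 : ℝ) := ⟨_, rfl⟩
  obtain ⟨d, hd⟩ : ∃ d, d = (M + 1 : ℝ) ^ (1 / 3 : ℝ) := ⟨_, rfl⟩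
  obtain ⟨t, ht⟩ : ∃ t, t = (T : ℝ) ^ (1 / 3 : ℝ) := ⟨_, rfl⟩
  obtain ⟨l, hl⟩ : ∃ l, l = L ^ (1 / 3 : ℝ) := ⟨_, rfl⟩
  have ha0 : 0 < a := ha ▸ hroot (by positivity)
  have hb0 : 0 < b := hb ▸ hroot (by positivity)
  have hd0 : 0 < d := hd ▸ hroot (by positivity)
  have ht0 : 0 < t := ht ▸ hroot (by positivity)
  have hl0 : 0 < l := hl ▸ hroot hL0
  have ha3 : a ^ 3 = n * k := ha ▸ rpow_third_pow (by positivity)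
  have hb3 : b ^ 3 = M := hb ▸ rpow_third_pow (by positivity)
  have hd3 : d ^ 3 = M + 1 := hd ▸ rpow_third_pow (by positivity)
  have ht3 : t ^ 3 = T := ht ▸ rpow_third_pow (by positivity)
  have hl3 : l ^ 3 = L := hl ▸ rpow_third_pow hL0.le
  have hle : ∀ {x y : ℝ}, 0 ≤ y → x ^ 3 ≤ y ^ 3 → x ≤ y := fun hy h =>
    le_of_pow_le_pow_left₀ (by norm_num) hy h
  have hl2 : 1 / 2 ≤ l := hle hl0.le (by rw [hl3]; norm_num; linarith)
  have ht1 : 1 ≤ t := hle ht0.le (by rw [ht3]; linarith)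
  have hat : a ≤ t := hle ht0.le (by rw [ha3, ht3]; exact hTnk)
  have ha1 : 1 ≤ a := hle ha0.le (by rw [ha3]; norm_num; exact_mod_cast Nat.mul_pos hn hk)
  have hbd : b ≤ d := hle hd0.le (by rw [hb3, hd3]; linarith)
  have hd2 : d ^ 2 ≤ 2 * b ^ 2 := by
    have h1 : (d ^ 2) ^ 3 ≤ (2 * b ^ 2) ^ 3 := by
      have e1 : (d ^ 2) ^ 3 = (M + 1 : ℝ) ^ 2 := by rw [← hd3]; ring
      have e2 : (2 * b ^ 2) ^ 3 = 8 * (M : ℝ) ^ 2 := by rw [← hb3]; ring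
      rw [e1, e2]
      nlinarith
    exact hle (by positivity) h1
  have hx : m = ⌈d ^ 2 * t ^ 2 * l / (2 * (a * b) ^ 2)⌉₊ := by
    rw [hm, cetcReps, rpow_two_thirds (by positivity), rpow_two_thirds (by positivity),
      rpow_two_thirds (by positivity), ← hd, ← ht, ← hl]
    push_cast
    rw [Real.mul_rpow (by positivity) (by positivity), ← ha, ← hb]
  set x := d ^ 2 * t ^ 2 * l / (2 * (a * b) ^ 2) with hxdef
  have hx0 : 0 < x := by positivity
  have hm0 : 0 < m := hx ▸ Nat.ceil_pos.2 hx0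
  have hxm : x ≤ m := hx ▸ Nat.le_ceil x
  have hmx : (m : ℝ) ≤ x + 1 := hx ▸ (Nat.ceil_lt_add_one hx0.le).le
  have hm0' : (0 : ℝ) < m := by exact_mod_cast hm0
  refine ⟨hm0, ?_⟩
  have hR : 10 * (n : ℝ) ^ (1 / 3 : ℝ) * (k : ℝ) ^ (1 / 3 : ℝ) * M * (T : ℝ) ^ (2 / 3 : ℝ) *
      L ^ (1 / 3 : ℝ) = 10 * (a * b ^ 3 * t ^ 2 * l) := by
    rw [rpow_two_thirds (by positivity), ← ht, ← hl, ha,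
      Real.mul_rpow (by positivity) (by positivity), hb3]
    ring
  rw [hR, ← ha3, ← hb3, ← ht3]
  set R := a * b ^ 3 * t ^ 2 * l with hRdef
  have hMR : b ^ 3 ≤ 2 * R := by
    have h1 : b ^ 3 * 1 ≤ b ^ 3 * (a * t ^ 2 * (2 * l)) := by
      gcongr
      have : 1 ≤ 2 * l := by linarith
      have : 1 ≤ t ^ 2 := one_le_pow₀ ht1
      have : 1 ≤ a * t ^ 2 := one_le_mul_of_one_le_of_one_le ha1 this
      exact one_le_mul_of_one_le_of_one_le this (by linarith)
    calc b ^ 3 = b ^ 3 * 1 := by ring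
      _ ≤ _ := h1
      _ = 2 * R := by rw [hRdef]; ring
  -- The cost of rounding `m` up, controlled by `a ≤ t`, that is `n k ≤ T`.
  have hNR : a ^ 3 * b ^ 3 ≤ 2 * R := by
    calc a ^ 3 * b ^ 3 = a * b ^ 3 * a ^ 2 * 1 := by ring
      _ ≤ a * b ^ 3 * t ^ 2 * (2 * l) := by gcongr; linarith
      _ = 2 * R := by rw [hRdef]; ring
  have hNm : a ^ 3 * b ^ 3 * m ≤ 3 * R := by
    have h1 : a ^ 3 * b ^ 3 * x ≤ R := by
      calc a ^ 3 * b ^ 3 * x = d ^ 2 * (a * b * t ^ 2 * l / 2) := by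
            rw [hxdef]; field_simp
        _ ≤ 2 * b ^ 2 * (a * b * t ^ 2 * l / 2) := by gcongr
        _ = R := by rw [hRdef]; ring
    calc a ^ 3 * b ^ 3 * m ≤ a ^ 3 * b ^ 3 * (x + 1) := by gcongr
      _ = a ^ 3 * b ^ 3 * x + a ^ 3 * b ^ 3 := by ring
      _ ≤ 3 * R := by linarith
  have hεR : t ^ 3 * (b ^ 3 * √(L / m)) ≤ 2 * R := by
    have h1 : √(L / m) ≤ 2 * (a * l / t) := by
      refine Real.sqrt_le_iff.2 ⟨by positivity, ?_⟩
      calc L / m ≤ l ^ 3 / x := by rw [hl3]; gcongr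
        _ = b ^ 2 / d ^ 2 * (2 * (a * l / t) ^ 2) := by rw [hxdef]; field_simp
        _ ≤ 1 * (2 * (a * l / t) ^ 2) := by
            gcongr
            rw [div_le_one (by positivity)]
            gcongr
        _ ≤ (2 * (a * l / t)) ^ 2 := by nlinarith [sq_nonneg (a * l / t)]
    calc t ^ 3 * (b ^ 3 * √(L / m)) ≤ t ^ 3 * (b ^ 3 * (2 * (a * l / t))) := by gcongr
      _ = 2 * R := by rw [hRdef]; field_simp
  -- The choice of `ε` makes the exponent `-2 log T`.
  have hexp : Real.exp (-2 * m * √(L / m) ^ 2) = 1 / (t ^ 3) ^ 2 := by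
    rw [Real.sq_sqrt (by positivity), ht3]
    have : -2 * (m : ℝ) * (L / m) = -(Real.log T + Real.log T) := by rw [← hL]; field_simp; ring
    rw [this, Real.exp_neg, Real.exp_add, Real.exp_log (by linarith)]
    field_simp
  have hbad : t ^ 3 * (a ^ 3 * b ^ 3 * (2 * Real.exp (-2 * m * √(L / m) ^ 2))) ≤ 4 * R := by
    rw [hexp]
    calc t ^ 3 * (a ^ 3 * b ^ 3 * (2 * (1 / (t ^ 3) ^ 2))) = 2 * b ^ 3 * (a / t) ^ 3 := by
          field_simp
      _ ≤ 2 * b ^ 3 * 1 := by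
          gcongr
          exact pow_le_one₀ (by positivity) ((div_le_one ht0).2 hat)
      _ ≤ 4 * R := by linarith
  have : 0 < R := by positivity
  linarith

end KBandit

theorem mainTheorem4 :
    ∃ C : ℝ, 0 < C ∧
      ∀ (n k M T : ℕ) (𝓜 : Matroid (Fin n)) (rule : GreedyRule k 𝓜)
        (Ω : Type*) [MeasurableSpace Ω] (P : Measure Ω) [IsProbabilityMeasure P]
        (F : ℕ → Ω → Assignment n k → ℝ) (OPT : Assignment n k),
        0 < k →
        𝓜.E = Set.univ →
        𝓜.eRank = M →
        IsRewardProcess P F →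
        IsKSubmodular (expectedReward P F) →
        IsMonotone (expectedReward P F) →
        OPT ∈ feasible k 𝓜 →
        IsMaxOn (expectedReward P F) (feasible k 𝓜) OPT →
        (n : ℝ) * k * max 1 (3 * √2 * M / (2 * (M + 1))) ≤ T →
        expectedRegret P F (1 / 2) T OPT
            (fun t ω => greedyCETC rule M T (fun s => F s ω) t) ≤
          C * (n : ℝ) ^ (1 / 3 : ℝ) * (k : ℝ) ^ (1 / 3 : ℝ) * M * (T : ℝ) ^ (2 / 3 : ℝ) *
            Real.log T ^ (1 / 3 : ℝ) := by
  refine ⟨10, by norm_num, ?_⟩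
  intro n k M T 𝓜 rule Ω _ P _ F OPT hk _ hrank hF hsub hmono hOPT _ hT
  -- In rank `0` the empty solution is the only feasible one and is played throughout, so the regret
  -- is nonpositive.
  rcases Nat.eq_zero_or_pos M with rfl | hM
  · have hnone : ∀ x ∈ feasible k 𝓜, x = fun _ => none := by
      intro x hx
      have h0 : (support x).encard = 0 := by
        simpa [hrank] using Matroid.Indep.encard_le_eRank hx
      funext e
      by_contra he
      exact Set.notMem_empty e (Set.encard_eq_zero.1 h0 ▸ he)
    rw [hnone OPT hOPT, expectedRegret]
    simp only [greedyCETC, greedy, greedyFrom, OracleAlg.cetcAction]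
    rw [integral_finsetSum _ fun t _ => Integrable.of_mem_Icc 0 1
      (hF.measurable_apply t _).aemeasurable (hF.mem_Icc t _)]
    simp only [hF.integral_eq, Finset.sum_const, Finset.card_range, nsmul_eq_mul]
    have h0 := (hF.expectedReward_mem_Icc (fun _ => none : Assignment n k)).1
    have : (0 : ℝ) ≤ T * expectedReward P F (fun _ => none) := by positivity
    push_cast
    linarith
  · have hn : 0 < n := by
      rcases Nat.eq_zero_or_pos n with rfl | hn
      · have : 𝓜.eRank ≤ 0 := by
          simpa using 𝓜.eRank_le_encard_ground.trans (Set.encard_le_encard (Set.subset_univ _))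
        rw [hrank] at this
        norm_cast at this
        omega
      · exact hn
    have hnk : (1 : ℝ) ≤ n * k := by exact_mod_cast Nat.mul_pos hn hk
    have hM1 : (1 : ℝ) ≤ M := by exact_mod_cast hM
    -- For `M ≥ 1` the quotient is at least `3√2 / 4 > 1`; this forces `T ≥ 2`, hence `log T > 0`.
    have hmax : 1 < 3 * √2 * M / (2 * (M + 1)) := by
      rw [one_lt_div (by positivity)]
      have : (1.4 : ℝ) < √2 := Real.lt_sqrt_of_sq_lt (by norm_num)
      nlinarith
    have hTnk : (n * k : ℝ) ≤ T :=
      (le_mul_of_one_le_right (by positivity) (le_max_left _ _)).trans hT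
    have hT2 : 2 ≤ T := by
      have : (1 : ℝ) < T := by
        refine lt_of_lt_of_le ?_ hT
        exact hmax.trans_le ((le_max_right _ _).trans (le_mul_of_one_le_left (by positivity) hnk))
      exact_mod_cast this
    obtain ⟨hm0, hbound⟩ := parameter_bound hn hk hM hT2 hTnk rfl
    exact (greedyCETC_regret_le rule hk hrank hF hsub hmono hOPT rfl hm0
      (Real.sqrt_nonneg _)).trans hbound
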